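/- Let $k$ be a field, let $K$ be a field extension of $k$, and let $R=k(x)\subseteq K$ be a rational function field over $k$ (that is, $x$ is transcendental over $k$) with $[K:R]=2$, such that $K$ has a non-trivial $R$-automorphism $\sigma$. (For instance, $K$ is a hyperelliptic or elliptic function field over a perfect field $k$ and $R$ is a rational subfield of index $2$.) A place $\mathfrak p$ of $K$ (or of $R$) is a discrete valuation ring containing $k$ with field of fractions $K$ (or $R$), and $\deg\mathfrak p$ is the degree over $k$ of its residue field; $\nu_{\mathfrak p}(D)$ is the coefficient of a divisor $D$ at $\mathfrak p$, and $\operatorname{Con}_{K/R}(D')=\sum_{\mathfrak p}e(\mathfrak p\mid\mathfrak p\cap R)\,\nu_{\mathfrak p\cap R}(D')\,\mathfrak p$ for $D'\in\operatorname{Div}(R)$. For an arbitrary set $S$ of places of $K$ and $d\ge 0$ put \[ \operatorname{Red}_S^d(K)=\{D\in\operatorname{Div}(K) : D\ge 0,\ \deg D=d,\ \nu_{\mathfrak q}(D)=0 \text{ for all } \mathfrak q\in S,\ \forall D'\in\operatorname{Div}(R)\,(\operatorname{Con}_{K/R}(D')\le D\Rightarrow D'\le 0)\}. \] If $k$ is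 finite, then all sets $\operatorname{Red}_S^d(K)$ are finite. Now let $k$ be arbitrary, let $S$ be a set of places of $K$ such that $\operatorname{Red}_S^d(K)$ is finite for every $d\ge 0$, and for $T\supseteq S$ put $h_T(t)=\sum_{n\ge 0}|\operatorname{Red}_T^n(K)|\,t^n\in\mathbb Q[[t]]$. Let $\mathfrak p_1,\mathfrak p_2\notin S$ be places of $K$, $S'=S\cup\{\mathfrak p_1,\mathfrak p_2\}$ and $\delta=\deg\mathfrak p_1$. (a) If $\mathfrak p_1\ne\mathfrak p_2=\sigma(\mathfrak p_1)$, then $h_{S'}(t)=\dfrac{1-t^{\delta}}{1+t^{\delta}}\,h_S(t)$. (b) If $\mathfrak p_1=\mathfrak p_2=\sigma(\mathfrak p_1)$ and $\mathfrak p_1\cap R$ is not inert in $K$, then $h_{S'}(t)=\dfrac{1}{1+t^{\delta}}\,h_S(t)$. (c) If $\mathfrak p_1=\mathfrak p_2=\sigma(\mathfrak p_1)$ and $\mathfrak p_1\cap R$ is inert in $K$, then $h_{S'}(t)=h_S(t)$. (d) If $\mathfrak p_1=\mathfrak p_2$ and $\sigma(\mathfrak p_1)\in S$, then $h_{S'}(t)=(1-t^{\delta})\,h_S(t)$.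 -/

import Mathlib

namespace FuncField

/-- A place of a function field `F` over `k`: a discrete valuation ring containing `k` whose
field of fractions is `F`. -/
@[ext]
structure Place (k F : Type*) [Field k] [Field F] [Algebra k F] where
  /-- the valuation ring of the place -/
  valRing : ValuationSubring F
  algebraMap_mem : ∀ c : k, algebraMap k F c ∈ valRing
  isDVR : IsDiscreteValuationRing valRing

attribute [instance] Place.isDVR

namespace Place

noncomputable instance instAlgebraValRing {k F : Type*} [Field k] [Field F] [Algebra k F]
    (p : Place k F) : Algebra k p.valRing :=
  ((algebraMap k F).codRestrict p.valRing p.algebraMap_mem).toAlgebra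

/-- The degree of a place: the dimension over `k` of its residue field. -/
noncomputable def deg {k F : Type*} [Field k] [Field F] [Algebra k F] (p : Place k F) : ℕ :=
  Module.finrank k (IsLocalRing.ResidueField p.valRing)

section Extension

variable {k F K : Type*} [Field k] [Field F] [Field K] [Algebra k F] [Algebra k K] [Algebra F K]

/-- The inclusion of the valuation ring `O ∩ F` into the valuation ring `O`. -/
noncomputable def comapHom (F : Type*) {K : Type*} [Field F] [Field K] [Algebra F K]
    (O : ValuationSubring K) : O.comap (algebraMap F K) →+* O :=
  ((algebraMap F K).comp (O.comap (algebraMap F K)).subtype).codRestrict O fun a => a.2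

theorem comapHom_injective (O : ValuationSubring K) : Function.Injective (comapHom F O) := by
  intro a b h
  apply Subtype.ext
  exact (algebraMap F K).injective (congrArg Subtype.val h)

theorem comapHom_dvd (O : ValuationSubring K) {a b : O.comap (algebraMap F K)}
    (h : comapHom F O a ∣ comapHom F O b) : a ∣ b := by
  by_cases ha : a = 0
  · subst ha
    rw [map_zero, zero_dvd_iff] at h
    have : b = 0 := comapHom_injective O (by rw [h, map_zero])
    rw [this]
  · obtain ⟨c, hc⟩ := h
    have ha' : (a : F) ≠ 0 := fun h0 => ha (Subtype.ext h0)
    have hc' : algebraMap F K (b : F) = algebraMap F K (a : F) * (c : K) :=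
      congrArg Subtype.val hc
    have hne : algebraMap F K (a : F) ≠ 0 := by simpa using ha'
    have hq : algebraMap F K ((b : F) / (a : F)) = (c : K) := by
      rw [map_div₀, hc']
      field_simp
    refine ⟨⟨(b : F) / (a : F), ?_⟩, ?_⟩
    · rw [ValuationSubring.mem_comap, hq]
      exact c.2
    · apply Subtype.ext
      change (b : F) = (a : F) * ((b : F) / (a : F))
      field_simp

theorem isDVR_comap [Algebra.IsAlgebraic F K] (O : ValuationSubring K)
    [IsDiscreteValuationRing O] :
    IsDiscreteValuationRing (O.comap (algebraMap F K)) := by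
  have hnf : ¬ IsField (O.comap (algebraMap F K)) := by
    intro hA
    have htop : ∀ x : F, algebraMap F K x ∈ O := by
      intro x
      rcases (O.comap (algebraMap F K)).mem_or_inv_mem x with hx | hx
      · exact hx
      · by_cases h0 : x = 0
        · subst h0
          rw [map_zero]
          exact O.zero_mem
        · obtain ⟨y, hy⟩ := hA.mul_inv_cancel (a := ⟨x⁻¹, hx⟩)
            (fun h => h0 (inv_eq_zero.mp (congrArg Subtype.val h)))
          have hy' : x⁻¹ * (y : F) = 1 := congrArg Subtype.val hy
          have : (y : F) = x := by
            field_simp at hy'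
            exact hy'
          rw [← this]
          exact y.2
    have hall : ∀ z : K, z ∈ O := by
      intro z
      obtain ⟨P, hP, hPz⟩ := Algebra.IsIntegral.isIntegral (R := F) z
      have : IsIntegral O z := by
        refine ⟨P.map ((algebraMap F K).codRestrict O htop), hP.map _, ?_⟩
        rw [Polynomial.eval₂_map]
        exact hPz
      obtain ⟨w, hw⟩ := IsIntegrallyClosed.isIntegral_iff.mp this
      rw [← hw]
      exact w.2
    apply IsDiscreteValuationRing.not_isField O
    refine ⟨⟨0, 1, zero_ne_one⟩, mul_comm, fun {a} ha => ⟨⟨(a : K)⁻¹, hall _⟩, ?_⟩⟩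
    apply Subtype.ext
    change (a : K) * (a : K)⁻¹ = 1
    exact mul_inv_cancel₀ fun h => ha (Subtype.ext h)
  have hpir : IsPrincipalIdealRing (O.comap (algebraMap F K)) := by
    refine ⟨fun I => ?_⟩
    obtain ⟨a, haI, hmin⟩ : ∃ a ∈ I, ∀ b ∈ I,
        IsDiscreteValuationRing.addVal O (comapHom F O a) ≤
          IsDiscreteValuationRing.addVal O (comapHom F O b) := by
      have hwf := WellFounded.has_min (wellFounded_lt (α := ℕ∞))
        ((fun a => IsDiscreteValuationRing.addVal O (comapHom F O a)) '' (I : Set _))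
        ⟨_, 0, I.zero_mem, rfl⟩
      obtain ⟨_, ⟨a, ha, rfl⟩, hmin⟩ := hwf
      exact ⟨a, ha, fun b hb => not_lt.mp (hmin _ ⟨b, hb, rfl⟩)⟩
    refine ⟨a, le_antisymm (fun b hb => ?_) ?_⟩
    · refine Ideal.mem_span_singleton.mpr (comapHom_dvd O ?_)
      exact IsDiscreteValuationRing.addVal_le_iff_dvd.mp (hmin b hb)
    · exact (Ideal.span_singleton_le_iff_mem I).mpr haI
  exact { hpir with
    not_a_field' := fun h => hnf (IsLocalRing.isField_iff_maximalIdeal_eq.mpr h) }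

variable [IsScalarTower k F K]

variable (F) in
/-- The place `p ∩ F` of `F` lying below a place `p` of the algebraic extension `K` of `F`. -/
noncomputable def below [Algebra.IsAlgebraic F K] (p : Place k K) : Place k F where
  valRing := p.valRing.comap (algebraMap F K)
  algebraMap_mem c := by
    rw [ValuationSubring.mem_comap, ← IsScalarTower.algebraMap_apply]
    exact p.algebraMap_mem c
  isDVR := isDVR_comap p.valRing

variable (F) in
/-- The inclusion of the valuation ring of `p ∩ F` into that of `p`. -/
noncomputable def belowHom [Algebra.IsAlgebraic F K] (p : Place k K) :
    (p.below F).valRing →+* p.valRing :=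
  comapHom F p.valRing

theorem belowHom_injective [Algebra.IsAlgebraic F K] (p : Place k K) :
    Function.Injective (p.belowHom F) :=
  comapHom_injective p.valRing

variable (F) in
/-- The ramification index of `p` over `p ∩ F`: the normalized valuation at `p` of a uniformizer
of `p ∩ F`. -/
noncomputable def ramIdx [Algebra.IsAlgebraic F K] (p : Place k K) : ℕ :=
  (IsDiscreteValuationRing.addVal p.valRing
    (p.belowHom F
      (IsDiscreteValuationRing.exists_irreducible (p.below F).valRing).choose)).toNat

/-- The ramification index may be computed with any uniformizer of `p ∩ F`. -/
theorem addVal_belowHom [Algebra.IsAlgebraic F K] (p : Place k K)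
    {ϖ : (p.below F).valRing} (hϖ : Irreducible ϖ) :
    IsDiscreteValuationRing.addVal p.valRing (p.belowHom F ϖ) = p.ramIdx F := by
  have hspec := (IsDiscreteValuationRing.exists_irreducible (p.below F).valRing).choose_spec
  have hassoc := IsDiscreteValuationRing.associated_of_irreducible _ hspec hϖ
  rw [← (IsDiscreteValuationRing.addVal_eq_iff_associated _ _).mpr (hassoc.map (p.belowHom F)),
    ramIdx, ENat.natCast_toNat]
  rw [Ne, IsDiscreteValuationRing.addVal_eq_top_iff]
  intro h
  exact hspec.ne_zero (belowHom_injective p (by rw [h, map_zero]))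

/-- The place `σ(p)` of `K`, whose valuation ring is the image under `σ` of that of `p`. -/
noncomputable def conj (σ : K ≃ₐ[F] K) (p : Place k K) : Place k K where
  valRing := p.valRing.comap (σ.symm : K →+* K)
  algebraMap_mem c := by
    rw [ValuationSubring.mem_comap, IsScalarTower.algebraMap_apply k F K]
    simp only [RingHom.coe_coe, AlgEquiv.commutes]
    rw [← IsScalarTower.algebraMap_apply]
    exact p.algebraMap_mem c
  isDVR := by
    let e : p.valRing ≃+* p.valRing.comap (σ.symm : K →+* K) :=
      { toFun := fun a => ⟨σ a, by
          rw [ValuationSubring.mem_comap]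
          simp⟩
        invFun := fun b => ⟨σ.symm b, b.2⟩
        left_inv := fun a => Subtype.ext (by simp)
        right_inv := fun b => Subtype.ext (by simp)
        map_mul' := fun a b => Subtype.ext (by simp)
        map_add' := fun a b => Subtype.ext (by simp) }
    exact IsDiscreteValuationRing.RingEquivClass.isDiscreteValuationRing e

theorem coe_conj (σ : K ≃ₐ[F] K) (p : Place k K) :
    ((p.conj σ).valRing : Set K) = σ '' (p.valRing : Set K) := by
  ext y
  constructor
  · intro hy
    exact ⟨σ.symm y, hy, by simp⟩
  · rintro ⟨x, hx, rfl⟩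
    change σ.symm (σ x) ∈ p.valRing
    simpa using hx

variable (K) in
/-- A place `q` of `F` is inert in `K` if there is exactly one place of `K` above it, and this
place is unramified over `q`; in other words, if the conorm of `q` is a single place. -/
def IsInert [Algebra.IsAlgebraic F K] (q : Place k F) : Prop :=
  ∃ p : Place k K, (∀ p' : Place k K, p'.below F = q ↔ p' = p) ∧ p.ramIdx F = 1

end Extension

end Place

/-- The divisor group of the function field `F` over `k`. -/
abbrev Divisor (k F : Type*) [Field k] [Field F] [Algebra k F] : Type _ := Place k F →₀ ℤ

namespace Divisor

/-- The degree of a divisor. -/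
noncomputable def deg {k F : Type*} [Field k] [Field F] [Algebra k F] (D : Divisor k F) : ℤ :=
  D.sum fun p n => n * (p.deg : ℤ)

/-- The conorm of a divisor `D` of `F` in the extension `K`, as the family of its coefficients:
the coefficient at `p` is `e(p | p ∩ F)` times the coefficient of `D` at `p ∩ F`. -/
noncomputable def conorm {k F : Type*} (K : Type*) [Field k] [Field F] [Field K] [Algebra k F]
    [Algebra k K] [Algebra F K] [IsScalarTower k F K] [Algebra.IsAlgebraic F K]
    (D : Divisor k F) : Place k K → ℤ :=
  fun p => (p.ramIdx F : ℤ) * D (p.below F)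

end Divisor

section Reduced

variable {k K : Type*} [Field k] [Field K] [Algebra k K]

/-- `Red_S^d(K)`: effective divisors of degree `d` which vanish at all places of `S` and which
do not dominate the conorm of a divisor of `R`, except for divisors `≤ 0`. -/
def Red (R : IntermediateField k K) [Algebra.IsAlgebraic R K] (S : Set (Place k K)) (d : ℕ) :
    Set (Divisor k K) :=
  {D | 0 ≤ D ∧ D.deg = d ∧ (∀ q ∈ S, D q = 0) ∧
    ∀ D' : Divisor k R, D'.conorm K ≤ ⇑D → D' ≤ 0}

/-- The generating function `h_S(t) = ∑ |Red_S^n(K)| t^n`. -/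
noncomputable def genFun (R : IntermediateField k K) [Algebra.IsAlgebraic R K]
    (S : Set (Place k K)) : PowerSeries ℚ :=
  PowerSeries.mk fun n => ((Red R S n).ncard : ℚ)

/-- `R` is a rational function field over `k`. -/
def IsRationalSubfield (R : IntermediateField k K) : Prop :=
  ∃ x : K, Transcendental k x ∧ R = IntermediateField.adjoin k {x}

end Reduced

end FuncField

open FuncField

/-!
Testing reducedness against the divisors `1 · q` of `R` shows that an effective divisor `D` is
reduced if and only if above every place `q` of `R` there is a place `p` of `K` with
`D p < e(p | q)` (`mem_Red_iff`). The condition is local on `R`, so passing from `S` to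
`S ∪ {p₁, p₂}` only concerns the fibre of `p₁ ∩ R`.

The fibres are described by the involution `σ`, all of whose traces and norms lie in `R`.
The places above `p ∩ R` are `p` and `σ(p)` (`Place.below_eq_iff`): elements integral at both are
integral over `p ∩ R`, and prime avoidance excludes a third place. If `p ≠ σ(p)`, weak
approximation gives a uniformizer at `p` that is a unit at `σ(p)`, whose norm shows `e = 1`
(`Place.ramIdx_eq_one`); if `p = σ(p)`, the norm of a uniformizer shows `e ∣ 2`
(`Place.ramIdx_dvd_two`). Therefore a reduced `D` satisfies `D p = 0` or `D (σ(p)) = 0` in the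
split case, `D p ∈ {0, 1}` in the ramified case and `D p = 0` in the inert case.

The functional equations follow by counting the `D` with `D p = 0` and those of the form
`D' + p` separately (`genFun_eq_add`). If `σ(p) ∈ S`, then `D'` ranges over the same set as `D`,
whence the factor `1 - t^δ`; in the ramified case `D'` is a reduced divisor with `D' p = 0`,
whence `1 + t^δ`. The split case is inclusion and exclusion on the conditions `D p = 0` and
`D (σ(p)) = 0`, each of which leads back to the case `σ(p) ∈ S`.

If `k` is finite and `R = k(x)`, then at every place `y = x` or `y = x⁻¹` is integral, and
its residue class is algebraic over `k`, generates the residue field of `p ∩ R`, and determines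
`p ∩ R` by its minimal polynomial, of degree at most `deg p`. So degrees of places are positive
and there are finitely many places of bounded degree, hence finitely many effective divisors of
given degree (`finite_Red`).
-/

namespace FuncField

/-! ### Discrete valuation rings of a field -/

section DVR

variable {K : Type*} [Field K] {A B : ValuationSubring K}

theorem valuation_eq_one_of_sub_one {x : K} (hx : A.valuation (x - 1) < 1) :
    A.valuation x = 1 := by
  have := A.valuation.map_add_eq_of_lt_left (x := 1) (y := x - 1) (by simpa using hx)
  simpa using this

/-- The value group of a discrete valuation ring is Archimedean. -/
theorem exists_valuation_pow_lt [IsDiscreteValuationRing A] {z y : K}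
    (hz : A.valuation z < 1) (hy : y ≠ 0) : ∃ N : ℕ, A.valuation z ^ N < A.valuation y := by
  obtain ⟨a, b, hb, rfl⟩ := IsFractionRing.div_surjective A y
  have ha : a ≠ 0 := by
    rintro rfl
    simp at hy
  have hb0 : A.valuation (b : K) ≠ 0 := by
    simpa using nonZeroDivisors.ne_zero hb
  have hab : A.valuation (a : K) ≤ A.valuation ((a : K) / b) := by
    rw [map_div₀, le_div_iff₀ (zero_lt_iff.mpr hb0)]
    exact mul_le_of_le_one_right' (A.valuation_le_one b)
  obtain ⟨ϖ, hϖ⟩ := IsDiscreteValuationRing.exists_irreducible A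
  obtain ⟨n, u, hu⟩ := IsDiscreteValuationRing.eq_unit_mul_pow_irreducible ha hϖ
  have hva : A.valuation (a : K) = A.valuation (ϖ : K) ^ n := by
    rw [hu]
    simp [A.valuation_unit]
  have hϖ0 : A.valuation (ϖ : K) ≠ 0 := by
    simpa using hϖ.ne_zero
  have hϖ1 : A.valuation (ϖ : K) < 1 := by
    rw [← ValuationSubring.valuation_lt_one_iff]
    exact hϖ.not_isUnit
  have hzA : z ∈ A := (A.valuation_le_one_iff z).mp hz.le
  have hzm : (⟨z, hzA⟩ : A) ∈ IsLocalRing.maximalIdeal A :=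
    (A.valuation_lt_one_iff _).mpr hz
  rw [hϖ.maximalIdeal_eq, Ideal.mem_span_singleton] at hzm
  obtain ⟨c, hc⟩ := hzm
  have hzϖ : A.valuation z ≤ A.valuation (ϖ : K) := by
    have : z = ϖ * c := congrArg Subtype.val hc
    rw [this, map_mul]
    exact mul_le_of_le_one_right' (A.valuation_le_one c)
  refine ⟨n + 1, lt_of_lt_of_le ?_ hab⟩
  rw [hva]
  refine (pow_le_pow_left' hzϖ _).trans_lt ?_
  exact pow_lt_pow_right_of_lt_one₀ (zero_lt_iff.mpr hϖ0) hϖ1 (Nat.lt_succ_self n)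

theorem valuationSubring_ne_top [IsDiscreteValuationRing A] : A ≠ ⊤ := by
  intro h
  apply IsDiscreteValuationRing.not_isField A
  refine ⟨⟨0, 1, zero_ne_one⟩, mul_comm, fun {a} ha => ⟨⟨(a : K)⁻¹, ?_⟩, ?_⟩⟩
  · exact h.ge (ValuationSubring.mem_top _)
  · exact Subtype.ext (mul_inv_cancel₀ fun h0 => ha (Subtype.ext h0))

/-- A discrete valuation ring is a maximal proper subring of its field of fractions. -/
theorem eq_of_le_of_isDVR [IsDiscreteValuationRing A] [IsDiscreteValuationRing B]
    (h : A ≤ B) : A = B :=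
  ValuationSubring.eq_of_le_of_ne_top _ h valuationSubring_ne_top

/-- Weak approximation for two discrete valuation rings: since neither contains the other, there
is `c` with a pole at `A` and a zero at `B`, and `1 / (1 + c)` has the required behaviour. -/
theorem exists_approx_zero_one [IsDiscreteValuationRing A] [IsDiscreteValuationRing B]
    (h : A ≠ B) : ∃ z : K, A.valuation z < 1 ∧ B.valuation (z - 1) < 1 := by
  obtain ⟨a, haA, haB⟩ := SetLike.not_le_iff_exists.mp fun hle => h (eq_of_le_of_isDVR hle)
  obtain ⟨b, hbB, hbA⟩ :=
    SetLike.not_le_iff_exists.mp fun hle => h.symm (eq_of_le_of_isDVR hle)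
  rw [← ValuationSubring.valuation_le_one_iff] at haA hbB
  rw [← ValuationSubring.valuation_le_one_iff, not_le] at haB hbA
  have ha0 : a ≠ 0 := by
    rintro rfl
    simp at haB
  have hcA : 1 < A.valuation (b / a) := by
    rw [map_div₀, lt_div_iff₀ (zero_lt_iff.mpr (by simpa using ha0)), one_mul]
    exact haA.trans_lt hbA
  have hcB : B.valuation (b / a) < 1 := by
    rw [map_div₀, div_lt_iff₀ (zero_lt_one.trans haB), one_mul]
    exact hbB.trans_lt haB
  have h1A : A.valuation (1 + b / a) = A.valuation (b / a) :=
    A.valuation.map_add_eq_of_lt_right (by simpa using hcA)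
  have h1B : B.valuation (1 + b / a) = 1 := by
    simpa using B.valuation.map_add_eq_of_lt_left (x := 1) (y := b / a) (by simpa using hcB)
  have hne : 1 + b / a ≠ 0 := by
    intro h0
    rw [h0, map_zero] at h1B
    exact zero_ne_one h1B
  refine ⟨(1 + b / a)⁻¹, ?_, ?_⟩
  · rw [map_inv₀, h1A]
    exact inv_lt_one_of_one_lt₀ hcA
  · have : (1 + b / a)⁻¹ - 1 = -(b / a * (1 + b / a)⁻¹) := by
      rw [eq_neg_iff_add_eq_zero, sub_add_eq_add_sub, ← one_add_mul, mul_inv_cancel₀ hne,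
        sub_self]
    rw [this, Valuation.map_neg, map_mul, map_inv₀, h1B]
    simpa using hcB

/-- A valuation at `A` may be prescribed together with the valuation `1`
at `B`. -/
theorem exists_valuation_eq_and_eq_one [IsDiscreteValuationRing A] [IsDiscreteValuationRing B]
    (h : A ≠ B) {t : K} (ht : t ≠ 0) :
    ∃ w : K, A.valuation w = A.valuation t ∧ B.valuation w = 1 := by
  obtain ⟨z, hzA, hzB⟩ := exists_approx_zero_one h
  obtain ⟨M, hM⟩ := exists_valuation_pow_lt hzA ht
  obtain ⟨N, hN⟩ := exists_valuation_pow_lt hzB (inv_ne_zero ht)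
  have hz1 : A.valuation (z - 1) = 1 := by
    simpa using A.valuation.map_sub_eq_of_lt_right (x := z) (y := 1) (by simpa using hzA)
  have hBt : B.valuation (t * (z - 1) ^ N) < 1 := by
    rw [map_mul, map_pow]
    have hvt : 0 < B.valuation t := zero_lt_iff.mpr (by simpa using ht)
    rw [map_inv₀] at hN
    calc B.valuation t * B.valuation (z - 1) ^ N
        < B.valuation t * (B.valuation t)⁻¹ := by gcongr
      _ = 1 := mul_inv_cancel₀ hvt.ne'
  have hAt : A.valuation (t * (z - 1) ^ N) = A.valuation t := by
    rw [map_mul, map_pow, hz1, one_pow, mul_one]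
  -- The first summand dominates at `A`, the second at `B`.
  refine ⟨t * (z - 1) ^ N + z ^ M, ?_, ?_⟩
  · rw [A.valuation.map_add_eq_of_lt_left, hAt]
    rwa [hAt, map_pow]
  · have hzM : B.valuation (z ^ M) = 1 := by
      rw [map_pow, valuation_eq_one_of_sub_one hzB, one_pow]
    rw [B.valuation.map_add_eq_of_lt_right, hzM]
    rwa [hzM]

end DVR

/-! ### Places in a quadratic extension -/

section Quadratic

variable {F K : Type*} [Field F] [Field K] [Algebra F K] [Algebra.IsQuadraticExtension F K]

theorem eq_refl_or_eq_of_quadratic {σ : K ≃ₐ[F] K} (hσ : σ ≠ AlgEquiv.refl) (τ : K ≃ₐ[F] K) :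
    τ = AlgEquiv.refl ∨ τ = σ := by
  classical
  by_contra! h
  have hcard : ({AlgEquiv.refl, σ, τ} : Finset (K ≃ₐ[F] K)).card = 3 :=
    Finset.card_eq_three.mpr ⟨_, _, _, hσ.symm, h.1.symm, h.2.symm, rfl⟩
  have h1 := Finset.card_le_univ ({AlgEquiv.refl, σ, τ} : Finset (K ≃ₐ[F] K))
  have h2 := AlgEquiv.card_le (F := F) (K := K)
  rw [Algebra.IsQuadraticExtension.finrank_eq_two] at h2
  omega

theorem apply_apply_of_quadratic (σ : K ≃ₐ[F] K) (x : K) : σ (σ x) = x := by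
  by_cases hσ : σ = AlgEquiv.refl
  · simp [hσ]
  · rcases eq_refl_or_eq_of_quadratic hσ (σ.trans σ) with h | h
    · exact DFunLike.congr_fun h x
    · have hx : σ x = x := σ.injective (DFunLike.congr_fun h x)
      rw [hx, hx]

theorem exists_algebraMap_eq_of_fixed {σ : K ≃ₐ[F] K} (hσ : σ ≠ AlgEquiv.refl) {x : K}
    (hx : σ x = x) : ∃ a : F, algebraMap F K a = x := by
  classical
  have hgal : IsGalois F K := by
    apply IsGalois.of_card_aut_eq_finrank
    refine le_antisymm ?_ ?_
    · rw [Nat.card_eq_fintype_card]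
      exact AlgEquiv.card_le
    · rw [Algebra.IsQuadraticExtension.finrank_eq_two, Nat.card_eq_fintype_card]
      exact Fintype.one_lt_card_iff.mpr ⟨_, _, hσ⟩
  refine (IsGalois.mem_range_algebraMap_iff_fixed x).mpr fun τ => ?_
  rcases eq_refl_or_eq_of_quadratic hσ τ with rfl | rfl
  · rfl
  · exact hx

theorem exists_algebraMap_eq_mul {σ : K ≃ₐ[F] K} (hσ : σ ≠ AlgEquiv.refl) (x : K) :
    ∃ a : F, algebraMap F K a = x * σ x :=
  exists_algebraMap_eq_of_fixed hσ (by rw [map_mul, apply_apply_of_quadratic, mul_comm])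

theorem exists_algebraMap_eq_add {σ : K ≃ₐ[F] K} (hσ : σ ≠ AlgEquiv.refl) (x : K) :
    ∃ a : F, algebraMap F K a = x + σ x :=
  exists_algebraMap_eq_of_fixed hσ (by rw [map_add, apply_apply_of_quadratic, add_comm])

end Quadratic

namespace Place

section Basic

variable {k K : Type*} [Field k] [Field K] [Algebra k K]

theorem eq_of_le {p p' : Place k K} (h : p.valRing ≤ p'.valRing) : p = p' :=
  Place.ext (eq_of_le_of_isDVR h)

theorem valRing_ne {p p' : Place k K} (h : p ≠ p') : p.valRing ≠ p'.valRing :=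
  fun he => h (Place.ext he)

end Basic

section Conj

variable {k F K : Type*} [Field k] [Field F] [Field K] [Algebra k F] [Algebra k K] [Algebra F K]
  [IsScalarTower k F K]

theorem mem_conj_iff (σ : K ≃ₐ[F] K) (p : Place k K) (x : K) :
    x ∈ (p.conj σ).valRing ↔ σ.symm x ∈ p.valRing :=
  ValuationSubring.mem_comap

theorem valuation_conj_lt_one_iff (σ : K ≃ₐ[F] K) (p : Place k K) (x : K) :
    (p.conj σ).valRing.valuation x < 1 ↔ p.valRing.valuation (σ.symm x) < 1 := by
  rw [← ValuationSubring.mem_nonunits_iff, ← ValuationSubring.mem_nonunits_iff,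
    ValuationSubring.mem_nonunits_iff_or, ValuationSubring.mem_nonunits_iff_or, mem_conj_iff,
    map_inv₀, map_eq_zero_iff _ σ.symm.injective]

theorem valuation_conj_eq_one_iff (σ : K ≃ₐ[F] K) (p : Place k K) (x : K) :
    (p.conj σ).valRing.valuation x = 1 ↔ p.valRing.valuation (σ.symm x) = 1 := by
  rw [eq_iff_le_not_lt, eq_iff_le_not_lt, valuation_conj_lt_one_iff,
    ValuationSubring.valuation_le_one_iff, ValuationSubring.valuation_le_one_iff, mem_conj_iff]

/-- Conjugation identifies the residue fields over `k`. -/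
theorem deg_conj (σ : K ≃ₐ[F] K) (p : Place k K) : (p.conj σ).deg = p.deg := by
  let e : p.valRing ≃ₐ[k] (p.conj σ).valRing :=
    { toFun := fun a => ⟨σ a, (mem_conj_iff σ p _).mpr (by simp)⟩
      invFun := fun b => ⟨σ.symm b, (mem_conj_iff σ p _).mp b.2⟩
      left_inv := fun a => Subtype.ext (by simp)
      right_inv := fun b => Subtype.ext (by simp)
      map_mul' := fun a b => Subtype.ext (by simp)
      map_add' := fun a b => Subtype.ext (by simp)
      commutes' := fun c => Subtype.ext <| by
        change σ (algebraMap k K c) = algebraMap k K c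
        rw [IsScalarTower.algebraMap_apply k F K, AlgEquiv.commutes] }
  exact (IsLocalRing.ResidueField.mapAlgEquiv e).toLinearEquiv.finrank_eq.symm

end Conj

section Ramification

variable {k F K : Type*} [Field k] [Field F] [Field K] [Algebra k F] [Algebra k K] [Algebra F K]
  [IsScalarTower k F K] [Algebra.IsAlgebraic F K]

theorem mem_below_iff (p : Place k K) (a : F) :
    a ∈ (p.below F).valRing ↔ algebraMap F K a ∈ p.valRing :=
  ValuationSubring.mem_comap

theorem valuation_below_lt_one_iff (p : Place k K) (a : F) :
    (p.below F).valRing.valuation a < 1 ↔ p.valRing.valuation (algebraMap F K a) < 1 := by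
  rw [← ValuationSubring.mem_nonunits_iff, ← ValuationSubring.mem_nonunits_iff,
    ValuationSubring.mem_nonunits_iff_or, ValuationSubring.mem_nonunits_iff_or, mem_below_iff,
    map_inv₀, map_eq_zero_iff _ (algebraMap F K).injective]

theorem below_conj (σ : K ≃ₐ[F] K) (p : Place k K) : (p.conj σ).below F = p.below F := by
  apply Place.ext
  ext a
  rw [mem_below_iff, mem_below_iff, mem_conj_iff, AlgEquiv.commutes]

theorem belowHom_coe (p : Place k K) (a : (p.below F).valRing) :
    (p.belowHom F a : K) = algebraMap F K a := rfl

/-- The normalized valuation at `p` takes values in the multiples of the ramification index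
on `F`. -/
theorem ramIdx_dvd (p : Place k K) {a : F} {x : p.valRing} (hx : algebraMap F K a = x) {n : ℕ}
    (hn : IsDiscreteValuationRing.addVal p.valRing x = n) : p.ramIdx F ∣ n := by
  have ha : a ∈ (p.below F).valRing := by
    rw [mem_below_iff, hx]
    exact x.2
  have hxa : x = p.belowHom F ⟨a, ha⟩ := Subtype.ext hx.symm
  have ha0 : (⟨a, ha⟩ : (p.below F).valRing) ≠ 0 := by
    intro h0
    rw [hxa, h0, map_zero, IsDiscreteValuationRing.addVal_zero] at hn
    exact ENat.top_ne_natCast n hn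
  obtain ⟨ϖ, hϖ⟩ := IsDiscreteValuationRing.exists_irreducible (p.below F).valRing
  obtain ⟨m, hm⟩ := IsDiscreteValuationRing.associated_pow_irreducible ha0 hϖ
  have h := (IsDiscreteValuationRing.addVal_eq_iff_associated _ _).mpr (hm.map (p.belowHom F))
  rw [← hxa, hn, map_pow, IsDiscreteValuationRing.addVal_pow, addVal_belowHom p hϖ,
    nsmul_eq_mul] at h
  exact ⟨m, by rw [mul_comm]; exact_mod_cast h⟩

theorem ramIdx_pos (p : Place k K) : 0 < p.ramIdx F := by
  obtain ⟨ϖ, hϖ⟩ := IsDiscreteValuationRing.exists_irreducible (p.below F).valRing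
  rw [Nat.pos_iff_ne_zero]
  intro h0
  have h := addVal_belowHom p hϖ
  rw [h0, Nat.cast_zero, IsDiscreteValuationRing.addVal_eq_zero_iff,
    ValuationSubring.valuation_eq_one_iff, belowHom_coe] at h
  have := (valuation_below_lt_one_iff p (ϖ : F)).mp
    ((ValuationSubring.valuation_lt_one_iff _ _).mp hϖ.not_isUnit)
  exact this.ne h

end Ramification

section Conjugate

variable {k F K : Type*} [Field k] [Field F] [Field K] [Algebra k F] [Algebra k K] [Algebra F K]
  [IsScalarTower k F K] [Algebra.IsQuadraticExtension F K]

theorem symm_apply_of_quadratic (σ : K ≃ₐ[F] K) (x : K) : σ.symm x = σ x := by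
  rw [AlgEquiv.symm_apply_eq, apply_apply_of_quadratic]

theorem conj_conj (σ : K ≃ₐ[F] K) (p : Place k K) : (p.conj σ).conj σ = p := by
  apply Place.ext
  ext x
  rw [mem_conj_iff, mem_conj_iff, symm_apply_of_quadratic, symm_apply_of_quadratic,
    apply_apply_of_quadratic]

/-- An element which is integral at `p` and at its conjugate has trace and norm in `p ∩ F`, hence
is integral at every place lying above `p ∩ F`. -/
theorem mem_of_below_eq {σ : K ≃ₐ[F] K} (hσ : σ ≠ AlgEquiv.refl) {p p' : Place k K}
    (h : p'.below F = p.below F) {x : K} (hx : x ∈ p.valRing) (hσx : σ x ∈ p.valRing) :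
    x ∈ p'.valRing := by
  obtain ⟨t, ht⟩ := exists_algebraMap_eq_add hσ x
  obtain ⟨n, hn⟩ := exists_algebraMap_eq_mul hσ x
  have htr : x + σ x ∈ p'.valRing := by
    rw [← ht, ← mem_below_iff, h, mem_below_iff, ht]
    exact add_mem hx hσx
  have hnm : x * σ x ∈ p'.valRing := by
    rw [← hn, ← mem_below_iff, h, mem_below_iff, hn]
    exact mul_mem hx hσx
  by_contra hxp
  have hinv : x⁻¹ ∈ p'.valRing := (p'.valRing.mem_or_inv_mem x).resolve_left hxp
  have hx0 : x ≠ 0 := by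
    rintro rfl
    exact hxp p'.valRing.zero_mem
  have : x = (x + σ x) - x * σ x * x⁻¹ := by
    field_simp
    ring
  rw [this] at hxp
  exact hxp (sub_mem htr (mul_mem hnm hinv))

/-- If every element integral at `p` and `σ(p)` that lies in the maximal ideal at `p'` also lies
in the maximal ideal at `p`, then `p'` equals `p`: every `y` integral at `p` is a fraction
`(y * b) / b` whose numerator and denominator are integral at `p` and `σ(p)`, with `b` a unit at
`p` and therefore at `p'`. -/
theorem exists_valuation_lt_one_and_eq_one {σ : K ≃ₐ[F] K} (hσ : σ ≠ AlgEquiv.refl)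
    {p p' : Place k K} (h : p'.below F = p.below F) (hne : p ≠ p') :
    ∃ x : K, x ∈ p.valRing ∧ σ x ∈ p.valRing ∧ p'.valRing.valuation x < 1 ∧
      p.valRing.valuation x = 1 := by
  by_contra! hcon
  apply hne
  refine eq_of_le fun y hy => ?_
  obtain ⟨b, hb, hσb, hyb⟩ : ∃ b : K, p.valRing.valuation b = 1 ∧ σ b ∈ p.valRing ∧
      σ (y * b) ∈ p.valRing := by
    by_cases hconj : p.conj σ = p
    · refine ⟨1, map_one _, by simp [one_mem], ?_⟩
      rw [mul_one, ← symm_apply_of_quadratic, ← mem_conj_iff, hconj]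
      exact hy
    · by_cases hy0 : y = 0
      · exact ⟨1, map_one _, by simp [one_mem], by simp [hy0, zero_mem]⟩
      obtain ⟨z, hz, hz1⟩ := exists_approx_zero_one (valRing_ne hconj)
      rw [valuation_conj_lt_one_iff, symm_apply_of_quadratic] at hz
      have hσy : σ y ≠ 0 := by simpa using hy0
      obtain ⟨N, hN⟩ := exists_valuation_pow_lt hz (inv_ne_zero hσy)
      refine ⟨z ^ N, ?_, ?_, ?_⟩
      · rw [map_pow, valuation_eq_one_of_sub_one hz1, one_pow]
      · rw [map_pow]
        exact pow_mem ((ValuationSubring.valuation_le_one_iff _ _).mp hz.le) N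
      · have hv : 0 < p.valRing.valuation (σ y) := zero_lt_iff.mpr (by simpa using hy0)
        rw [← ValuationSubring.valuation_le_one_iff, map_mul, map_mul, map_pow, map_pow]
        rw [map_inv₀] at hN
        calc p.valRing.valuation (σ y) * p.valRing.valuation (σ z) ^ N
            ≤ p.valRing.valuation (σ y) * (p.valRing.valuation (σ y))⁻¹ := by gcongr
          _ = 1 := mul_inv_cancel₀ hv.ne'
  have hbp : b ∈ p.valRing := (ValuationSubring.valuation_le_one_iff _ _).mp hb.le
  have hb' := mem_of_below_eq hσ h hbp hσb
  have hyb' := mem_of_below_eq hσ h (mul_mem hy hbp) hyb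
  rw [← ValuationSubring.valuation_le_one_iff] at hb' hyb'
  have hb1 : p'.valRing.valuation b = 1 :=
    hb'.antisymm (not_lt.mp fun hlt => hcon b hbp hσb hlt hb)
  rwa [map_mul, hb1, mul_one, ValuationSubring.valuation_le_one_iff] at hyb'

/-- The places above a given place of `F` are conjugate to each other. -/
theorem below_eq_iff {σ : K ≃ₐ[F] K} (hσ : σ ≠ AlgEquiv.refl) {p p' : Place k K} :
    p'.below F = p.below F ↔ p' = p ∨ p' = p.conj σ := by
  refine ⟨fun h => ?_, ?_⟩
  · by_contra! hne
    obtain ⟨x, hx, hσx, hx', hx1⟩ := exists_valuation_lt_one_and_eq_one hσ h hne.1.symm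
    obtain ⟨y, hσy, hy, hy', hy1⟩ := exists_valuation_lt_one_and_eq_one hσ
      (h.trans (below_conj σ p).symm) hne.2.symm
    rw [mem_conj_iff, symm_apply_of_quadratic] at hy hσy
    rw [apply_apply_of_quadratic] at hy
    rw [valuation_conj_eq_one_iff, symm_apply_of_quadratic] at hy1
    -- Prime avoidance: an element of the maximal ideal at `p'` which is a unit at the other two
    -- places.
    obtain ⟨w, hw', hw1, hσw1⟩ : ∃ w : K, p'.valRing.valuation w < 1 ∧
        p.valRing.valuation w = 1 ∧ p.valRing.valuation (σ w) = 1 := by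
      rcases ((ValuationSubring.valuation_le_one_iff _ _).mpr hσx).eq_or_lt with h1 | h1
      · exact ⟨x, hx', hx1, h1⟩
      rcases ((ValuationSubring.valuation_le_one_iff _ _).mpr hy).eq_or_lt with h2 | h2
      · exact ⟨y, hy', h2, hy1⟩
      refine ⟨x + y, Valuation.map_add_lt _ hx' hy', ?_, ?_⟩
      · rw [Valuation.map_add_eq_of_lt_left _ (by rwa [hx1]), hx1]
      · rw [map_add, Valuation.map_add_eq_of_lt_right _ (by rwa [hy1]), hy1]
    have hinv : w⁻¹ ∈ p'.valRing := by
      refine mem_of_below_eq hσ h ?_ ?_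
      · rw [← ValuationSubring.valuation_le_one_iff, map_inv₀, hw1, inv_one]
      · rw [← ValuationSubring.valuation_le_one_iff, map_inv₀, map_inv₀, hσw1, inv_one]
    have hw0 : p'.valRing.valuation w ≠ 0 := by
      rw [Valuation.ne_zero_iff]
      rintro rfl
      simp at hw1
    rw [← ValuationSubring.valuation_le_one_iff, map_inv₀] at hinv
    exact (one_lt_inv₀ (zero_lt_iff.mpr hw0)).mpr hw' |>.not_ge hinv
  · rintro (rfl | rfl)
    · rfl
    · exact below_conj σ p

/-- A place different from its conjugate is unramified: the norm of a uniformizer at `p` which is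
a unit at the conjugate place has valuation one at `p`. -/
theorem ramIdx_eq_one {σ : K ≃ₐ[F] K} (hσ : σ ≠ AlgEquiv.refl) {p : Place k K}
    (hp : p.conj σ ≠ p) : p.ramIdx F = 1 := by
  obtain ⟨π, hπ⟩ := IsDiscreteValuationRing.exists_irreducible p.valRing
  have hπ0 : (π : K) ≠ 0 := by simpa using hπ.ne_zero
  obtain ⟨w, hw, hw1⟩ := exists_valuation_eq_and_eq_one (valRing_ne hp.symm) hπ0
  rw [valuation_conj_eq_one_iff, symm_apply_of_quadratic] at hw1
  obtain ⟨a, ha⟩ := exists_algebraMap_eq_mul hσ w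
  obtain ⟨u, hu⟩ := (ValuationSubring.valuation_eq_iff _ _ _).mp
    (show p.valRing.valuation (w * σ w) = p.valRing.valuation (π : K) by
      rw [map_mul, hw, hw1, mul_one])
  have hdvd : p.ramIdx F ∣ 1 := by
    refine ramIdx_dvd p (a := a) (x := u * π) (by rw [ha, ← hu]; rfl) ?_
    rw [IsDiscreteValuationRing.addVal_mul, IsDiscreteValuationRing.addVal_uniformizer hπ,
      IsDiscreteValuationRing.addVal_eq_zero_of_unit]
    simp
  exact Nat.dvd_one.mp hdvd

/-- The norm of a uniformizer at a self-conjugate place has valuation two there. -/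
theorem ramIdx_dvd_two {σ : K ≃ₐ[F] K} (hσ : σ ≠ AlgEquiv.refl) {p : Place k K}
    (hp : p.conj σ = p) : p.ramIdx F ∣ 2 := by
  have hmem (x : K) (hx : x ∈ p.valRing) : σ x ∈ p.valRing := by
    rwa [← hp, mem_conj_iff, AlgEquiv.symm_apply_apply]
  have hm (x : K) (hx : p.valRing.valuation x < 1) : p.valRing.valuation (σ x) < 1 := by
    rwa [← symm_apply_of_quadratic, ← valuation_conj_lt_one_iff, hp]
  obtain ⟨π, hπ⟩ := IsDiscreteValuationRing.exists_irreducible p.valRing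
  let π' : p.valRing := ⟨σ π, hmem π π.2⟩
  have hdvd : π ∣ π' := by
    rw [← Ideal.mem_span_singleton, ← hπ.maximalIdeal_eq, ValuationSubring.valuation_lt_one_iff]
    exact hm π ((ValuationSubring.valuation_lt_one_iff _ _).mp hπ.not_isUnit)
  have hdvd' : π' ∣ π := by
    obtain ⟨c, hc⟩ := hdvd
    refine ⟨⟨σ c, hmem c c.2⟩, Subtype.ext ?_⟩
    have h1 : σ π = π * c := congrArg Subtype.val hc
    have h2 := congrArg σ h1
    rwa [map_mul, apply_apply_of_quadratic] at h2
  obtain ⟨a, ha⟩ := exists_algebraMap_eq_mul hσ (π : K)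
  refine ramIdx_dvd p (a := a) (x := π * π') ha ?_
  rw [IsDiscreteValuationRing.addVal_mul,
    ← (IsDiscreteValuationRing.addVal_eq_iff_associated π π').mpr
      (associated_of_dvd_dvd hdvd hdvd'),
    IsDiscreteValuationRing.addVal_uniformizer hπ]
  rfl

end Conjugate

end Place

/-! ### Reduced divisors and their generating functions -/

theorem constantCoeff_one_add_X_pow_ne_zero (n : ℕ) :
    PowerSeries.constantCoeff (1 + PowerSeries.X ^ n : PowerSeries ℚ) ≠ 0 := by
  -- For `n = 0` the constant coefficient is `2`.
  rcases n.eq_zero_or_pos with rfl | hn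
  · rw [pow_zero, map_add, map_one]
    norm_num
  · simp [hn.ne']

section Recursion

variable {k K : Type*} [Field k] [Field K] [Algebra k K]

namespace Divisor

theorem deg_add (D E : Divisor k K) : (D + E).deg = D.deg + E.deg :=
  Finsupp.sum_add_index' (fun p => by simp) (fun p m n => by ring)

theorem deg_single (p : Place k K) (n : ℤ) : deg (Finsupp.single p n) = n * (p.deg : ℤ) :=
  Finsupp.sum_single_index (by simp)

theorem deg_nonneg {D : Divisor k K} (hD : 0 ≤ D) : 0 ≤ D.deg :=
  Finset.sum_nonneg fun p _ => mul_nonneg (hD p) (Int.natCast_nonneg _)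

end Divisor

variable {R : IntermediateField k K}

section Algebraic

variable [Algebra.IsAlgebraic R K]

/-- A divisor is reduced if and only if it dominates the conorm of no single place: testing
against the divisors `1 · q` suffices. -/
theorem mem_Red_iff {S : Set (Place k K)} {d : ℕ} {D : Divisor k K} :
    D ∈ Red R S d ↔ 0 ≤ D ∧ D.deg = d ∧ (∀ q ∈ S, D q = 0) ∧
      ∀ q : Place k R, ∃ p : Place k K, p.below R = q ∧ D p < p.ramIdx R := by
  classical
  refine and_congr_right fun h0 => and_congr_right fun _ => and_congr_right fun _ => ?_
  constructor
  · intro h q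
    by_contra! hcon
    have hle := h (Finsupp.single q 1) fun p => by
      rw [Divisor.conorm, Finsupp.single_apply]
      split_ifs with hq
      · simpa using hcon p hq.symm
      · simpa using h0 p
    have := hle q
    simp at this
  · intro h D' hD' q
    obtain ⟨p, rfl, hp⟩ := h q
    have h1 : (p.ramIdx R : ℤ) * D' (p.below R) < p.ramIdx R * 1 := by
      rw [mul_one]
      exact (hD' p).trans_lt hp
    have h2 := lt_of_mul_lt_mul_left h1 (Int.natCast_nonneg _)
    exact Int.lt_add_one_iff.mp h2

theorem mem_Red_union_iff {S T : Set (Place k K)} {d : ℕ} {D : Divisor k K} :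
    D ∈ Red R (S ∪ T) d ↔ D ∈ Red R S d ∧ ∀ q ∈ T, D q = 0 := by
  simp only [Red, Set.mem_ofPred_eq, Set.mem_union, or_imp, forall_and]
  tauto

theorem Red_union_subset (S T : Set (Place k K)) (d : ℕ) : Red R (S ∪ T) d ⊆ Red R S d :=
  fun _ hD => (mem_Red_union_iff.mp hD).1

/-- Splitting the reduced divisors `D` according to whether `D p = 0`: if those with `D p > 0`
arise by adding `p` to the divisors of `Red_U`, the generating functions satisfy a recursion. -/
theorem genFun_eq_add {S U : Set (Place k K)} (hS : ∀ d, (Red R S d).Finite) (p : Place k K)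
    (h : ∀ (n : ℕ) (D : Divisor k K), 0 ≤ D →
      (D + Finsupp.single p 1 ∈ Red R S (n + p.deg) ↔ D ∈ Red R U n)) :
    genFun R S = genFun R (S ∪ {p}) + PowerSeries.X ^ p.deg * genFun R U := by
  classical
  ext n
  have hunion : Red R S n = Red R (S ∪ {p}) n ∪ {D ∈ Red R S n | 0 < D p} := by
    ext D
    rw [Set.mem_union, mem_Red_union_iff, Set.mem_ofPred_eq, ← and_or_left, iff_self_and]
    intro hD
    simpa using (hD.1 p).eq_or_lt'
  have hdisj : Disjoint (Red R (S ∪ {p}) n) {D ∈ Red R S n | 0 < D p} := by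
    rw [Set.disjoint_left]
    rintro D h1 ⟨-, h2⟩
    exact h2.ne' ((mem_Red_union_iff.mp h1).2 p rfl)
  have hsub {D : Divisor k K} (hD : 0 ≤ D) (hp : 0 < D p) :
      0 ≤ D - Finsupp.single p 1 := by
    intro q
    rw [Finsupp.sub_apply, Finsupp.single_apply]
    split_ifs with hq
    · subst hq
      simpa using Int.add_one_le_iff.mpr hp
    · simpa using hD q
  rw [map_add, PowerSeries.coeff_X_pow_mul', genFun, genFun, genFun, PowerSeries.coeff_mk,
    PowerSeries.coeff_mk, PowerSeries.coeff_mk, hunion,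
    Set.ncard_union_eq hdisj ((hS n).subset (Red_union_subset _ _ _))
      ((hS n).subset (Set.sep_subset _ _)), Nat.cast_add]
  congr 1
  split_ifs with hn
  · obtain ⟨m, rfl⟩ := Nat.exists_eq_add_of_le' hn
    rw [Nat.add_sub_cancel]
    have himage : {D ∈ Red R S (m + p.deg) | 0 < D p} =
        (fun D => D + Finsupp.single p 1) '' Red R U m := by
      ext D
      constructor
      · rintro ⟨hD, hp⟩
        refine ⟨D - Finsupp.single p 1, ?_, sub_add_cancel _ _⟩
        rw [← h m _ (hsub hD.1 hp), sub_add_cancel]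
        exact hD
      · rintro ⟨E, hE, rfl⟩
        refine ⟨(h m E hE.1).mpr hE, ?_⟩
        have := hE.1 p
        simp only [Finsupp.coe_zero, Pi.zero_apply] at this
        simp only [Finsupp.add_apply, Finsupp.single_eq_same]
        omega
    rw [himage, Set.ncard_image_of_injective _ (add_left_injective _)]
  · have hempty : {D ∈ Red R S n | 0 < D p} = ∅ := by
      rw [Set.eq_empty_iff_forall_notMem]
      rintro D ⟨hD, hp⟩
      have h1 := Divisor.deg_nonneg (hsub hD.1 hp)
      have h2 := Divisor.deg_add (D - Finsupp.single p 1) (Finsupp.single p 1)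
      rw [sub_add_cancel, hD.2.1, Divisor.deg_single] at h2
      omega
    rw [hempty, Set.ncard_empty, Nat.cast_zero]

/-- Adding a place `p ∉ S` only affects the reducedness condition at `p ∩ R`. -/
theorem add_single_mem_Red_iff {S : Set (Place k K)} {p : Place k K} (hpS : p ∉ S) {n : ℕ}
    {D : Divisor k K} (hD : 0 ≤ D) :
    D + Finsupp.single p 1 ∈ Red R S (n + p.deg) ↔
      D.deg = n ∧ (∀ q ∈ S, D q = 0) ∧
      (∃ p' : Place k K, p'.below R = p.below R ∧
        (D + Finsupp.single p 1 : Divisor k K) p' < p'.ramIdx R) ∧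
      ∀ q ≠ p.below R, ∃ p' : Place k K, p'.below R = q ∧ D p' < p'.ramIdx R := by
  classical
  have hne {q : Place k K} (hq : q ≠ p) : (D + Finsupp.single p 1 : Divisor k K) q = D q := by
    rw [Finsupp.add_apply, Finsupp.single_eq_of_ne hq, add_zero]
  have h0 : 0 ≤ D + Finsupp.single p 1 :=
    add_nonneg hD (Finsupp.single_nonneg.mpr zero_le_one)
  rw [mem_Red_iff, Divisor.deg_add, Divisor.deg_single, one_mul, Nat.cast_add, add_left_inj,
    and_iff_right h0]
  refine and_congr_right fun _ => and_congr ?_ ?_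
  · refine forall₂_congr fun q hq => ?_
    rw [hne (by rintro rfl; exact hpS hq)]
  · have hcongr : ∀ q ≠ p.below R, ((∃ p' : Place k K, p'.below R = q ∧
        (D + Finsupp.single p 1 : Divisor k K) p' < p'.ramIdx R) ↔
        ∃ p' : Place k K, p'.below R = q ∧ D p' < p'.ramIdx R) := by
      intro q hq
      refine exists_congr fun p' => and_congr_right fun hp' => ?_
      rw [hne (by rintro rfl; exact hq hp'.symm)]
    constructor
    · exact fun h => ⟨h _, fun q hq => (hcongr q hq).mp (h q)⟩
    · rintro ⟨h1, h2⟩ q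
      by_cases hq : q = p.below R
      · rw [hq]
        exact h1
      · exact (hcongr q hq).mpr (h2 q hq)

end Algebraic

section Cases

variable [Algebra.IsQuadraticExtension R K] {σ : K ≃ₐ[R] K} {S : Set (Place k K)}
  {p : Place k K}

/-- If `S` contains the conjugate of `p`, then the reducedness condition at `p ∩ R` is void, so
that multiples of `p` may be added freely. -/
theorem genFun_union_of_conj_mem (hS : ∀ d, (Red R S d).Finite) (hp : p ∉ S)
    (hσp : p.conj σ ∈ S) :
    genFun R (S ∪ {p}) = (1 - PowerSeries.X ^ p.deg) * genFun R S := by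
  rw [sub_mul, one_mul, eq_sub_iff_add_eq]
  refine (genFun_eq_add hS p fun n D hD => ?_).symm
  have hpσ : p.conj σ ≠ p := fun h => hp (h ▸ hσp)
  have hpos : (0 : ℤ) < (p.conj σ).ramIdx R := by
    exact_mod_cast Place.ramIdx_pos (p.conj σ)
  rw [add_single_mem_Red_iff hp hD, mem_Red_iff, and_iff_right hD]
  refine and_congr_right fun _ => and_congr_right fun hvan => ⟨?_, ?_⟩
  · rintro ⟨-, h⟩ q
    by_cases hq : q = p.below R
    · exact ⟨p.conj σ, hq ▸ Place.below_conj σ p, by rwa [hvan _ hσp]⟩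
    · exact h q hq
  · refine fun h => ⟨⟨p.conj σ, Place.below_conj σ p, ?_⟩, fun q _ => h q⟩
    rwa [Finsupp.add_apply, hvan _ hσp, Finsupp.single_eq_of_ne hpσ, add_zero]

theorem eq_of_below_eq_of_conj_eq (hσ : σ ≠ AlgEquiv.refl) (hp : p.conj σ = p)
    {p' : Place k K} (h : p'.below R = p.below R) : p' = p := by
  rcases (Place.below_eq_iff hσ).mp h with h | h
  · exact h
  · exact h.trans hp

/-- At a ramified place the coefficient of a reduced divisor is `0` or `1`. -/
theorem genFun_union_of_ramified (hσ : σ ≠ AlgEquiv.refl) (hS : ∀ d, (Red R S d).Finite)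
    (hpS : p ∉ S) (hp : p.conj σ = p) (he : p.ramIdx R = 2) :
    (1 + PowerSeries.X ^ p.deg) * genFun R (S ∪ {p}) = genFun R S := by
  rw [add_mul, one_mul]
  refine (genFun_eq_add hS p fun n D hD => ?_).symm
  rw [add_single_mem_Red_iff hpS hD, mem_Red_union_iff, mem_Red_iff, and_iff_right hD, and_assoc,
    and_assoc]
  refine and_congr_right fun _ => and_congr_right fun hvan => ⟨?_, ?_⟩
  · rintro ⟨⟨p', hp', hlt⟩, h⟩
    obtain rfl := eq_of_below_eq_of_conj_eq hσ hp hp'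
    rw [Finsupp.add_apply, Finsupp.single_eq_same, he] at hlt
    have h0 : 0 ≤ D p' := hD p'
    refine ⟨fun q => ?_, fun q hq => ?_⟩
    · by_cases hq : q = p'.below R
      · exact ⟨p', hq.symm, by rw [he]; omega⟩
      · exact h q hq
    · rw [Set.mem_singleton_iff.mp hq]
      omega
  · rintro ⟨h, h0⟩
    refine ⟨⟨p, rfl, ?_⟩, fun q _ => h q⟩
    rw [Finsupp.add_apply, h0 p rfl, Finsupp.single_eq_same, he]
    norm_num

/-- At an inert place the coefficient of a reduced divisor is `0`. -/
theorem genFun_union_of_inert (hσ : σ ≠ AlgEquiv.refl) (hp : p.conj σ = p)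
    (he : p.ramIdx R = 1) : genFun R (S ∪ {p}) = genFun R S := by
  have h (n : ℕ) : Red R (S ∪ {p}) n = Red R S n := by
    refine (Red_union_subset _ _ _).antisymm fun D hD => mem_Red_union_iff.mpr ⟨hD, ?_⟩
    rintro q rfl
    obtain ⟨p', hp', hlt⟩ := (mem_Red_iff.mp hD).2.2.2 (q.below R)
    obtain rfl := eq_of_below_eq_of_conj_eq hσ hp hp'
    have h0 : 0 ≤ D p' := hD.1 p'
    rw [he] at hlt
    omega
  simp only [genFun, h]

/-- At a split pair of conjugate places one of the two coefficients of a reduced divisor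
vanishes. -/
theorem Red_eq_union_of_split (hσ : σ ≠ AlgEquiv.refl) (hp : p.conj σ ≠ p) (n : ℕ) :
    Red R S n = Red R (S ∪ {p}) n ∪ Red R (S ∪ {p.conj σ}) n := by
  refine subset_antisymm (fun D hD => ?_)
    (Set.union_subset (Red_union_subset _ _ _) (Red_union_subset _ _ _))
  rw [Set.mem_union, mem_Red_union_iff, mem_Red_union_iff]
  obtain ⟨p', hp', hlt⟩ := (mem_Red_iff.mp hD).2.2.2 (p.below R)
  have h0 : 0 ≤ D p' := hD.1 p'
  rcases (Place.below_eq_iff hσ).mp hp' with rfl | rfl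
  · refine Or.inl ⟨hD, fun q hq => ?_⟩
    rw [Place.ramIdx_eq_one hσ hp] at hlt
    rw [Set.mem_singleton_iff.mp hq]
    omega
  · refine Or.inr ⟨hD, fun q hq => ?_⟩
    rw [Place.ramIdx_eq_one hσ (by rw [Place.conj_conj]; exact hp.symm)] at hlt
    rw [Set.mem_singleton_iff.mp hq]
    omega

theorem genFun_union_of_split (hσ : σ ≠ AlgEquiv.refl) (hS : ∀ d, (Red R S d).Finite)
    (hpS : p ∉ S) (hσpS : p.conj σ ∉ S) (hp : p.conj σ ≠ p) :
    (1 + PowerSeries.X ^ p.deg) * genFun R (S ∪ {p, p.conj σ}) =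
      (1 - PowerSeries.X ^ p.deg) * genFun R S := by
  have hfin (T : Set (Place k K)) (d : ℕ) : (Red R (S ∪ T) d).Finite :=
    (hS d).subset (Red_union_subset _ _ _)
  have hpair : S ∪ {p, p.conj σ} = S ∪ {p} ∪ {p.conj σ} := by
    rw [Set.union_assoc, Set.singleton_union]
  have hpair' : S ∪ {p, p.conj σ} = S ∪ {p.conj σ} ∪ {p} := by
    rw [Set.pair_comm, Set.union_assoc, Set.singleton_union]
  have h1 : genFun R (S ∪ {p, p.conj σ}) =
      (1 - PowerSeries.X ^ p.deg) * genFun R (S ∪ {p.conj σ}) := by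
    rw [hpair']
    refine genFun_union_of_conj_mem (σ := σ) (hfin _) ?_ (Or.inr rfl)
    rintro (h | h)
    · exact hpS h
    · exact hp h.symm
  have h2 : genFun R (S ∪ {p, p.conj σ}) =
      (1 - PowerSeries.X ^ p.deg) * genFun R (S ∪ {p}) := by
    rw [hpair, ← Place.deg_conj σ p]
    refine genFun_union_of_conj_mem (σ := σ) (hfin _) ?_ ?_
    · rintro (h | h)
      · exact hσpS h
      · exact hp h
    · rw [Place.conj_conj]
      exact Or.inr rfl
  have h3 : genFun R S + genFun R (S ∪ {p, p.conj σ}) =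
      genFun R (S ∪ {p}) + genFun R (S ∪ {p.conj σ}) := by
    ext n
    have hinter : Red R (S ∪ {p, p.conj σ}) n =
        Red R (S ∪ {p}) n ∩ Red R (S ∪ {p.conj σ}) n := by
      ext D
      simp only [Set.mem_inter_iff, mem_Red_union_iff, Set.mem_insert_iff,
        Set.mem_singleton_iff, forall_eq_or_imp, forall_eq]
      tauto
    rw [map_add, map_add, genFun, genFun, genFun, genFun]
    simp only [PowerSeries.coeff_mk]
    rw [hinter, Red_eq_union_of_split hσ hp n]
    exact_mod_cast Set.ncard_union_add_ncard_inter _ _ (hfin _ n) (hfin _ n)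
  linear_combination (PowerSeries.X ^ p.deg - 1) * h3 + h1 + h2

end Cases

end Recursion

/-! ### Finiteness over finite constant fields -/

open Polynomial in
/-- Elements of a simple extension `k(y)` are reduced fractions of polynomials in `y`; the
denominator is nonzero even where `y` is algebraic over `k`. -/
theorem exists_isCoprime_of_mem_adjoin {k K : Type*} [Field k] [Field K] [Algebra k K] {y r : K}
    (hr : r ∈ IntermediateField.adjoin k {y}) :
    ∃ g h : k[X], IsCoprime g h ∧ aeval y h ≠ 0 ∧ r = aeval y g / aeval y h := by
  classical
  obtain ⟨g, h, rfl⟩ := (IntermediateField.mem_adjoin_simple_iff k r).mp hr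
  by_cases h0 : aeval y h = 0
  · exact ⟨0, 1, isCoprime_one_right, by simp, by simp [h0]⟩
  let := EuclideanDomain.gcdMonoid k[X]
  obtain ⟨g', h', hg, hh, hu⟩ := extract_gcd g h
  rw [gcd_isUnit_iff] at hu
  set d := gcd g h
  have hd : aeval y h = aeval y d * aeval y h' := by rw [← map_mul, ← hh]
  rw [hd, ← Ne, mul_ne_zero_iff] at h0
  refine ⟨g', h', hu, h0.2, ?_⟩
  rw [hd, show aeval y g = aeval y d * aeval y g' by rw [← map_mul, ← hg],
    mul_div_mul_left _ _ h0.1]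

namespace Place

section Residue

variable {k K : Type*} [Field k] [Field K] [Algebra k K]

instance (p : Place k K) : IsScalarTower k p.valRing K :=
  IsScalarTower.of_algebraMap_eq fun _ => rfl

/-- The class of an integral element in the residue field of a place. -/
noncomputable def residue (p : Place k K) {y : K} (hy : y ∈ p.valRing) :
    IsLocalRing.ResidueField p.valRing :=
  IsLocalRing.residue p.valRing ⟨y, hy⟩

theorem residue_eq_zero_iff (p : Place k K) {y : K} (hy : y ∈ p.valRing) :
    p.residue hy = 0 ↔ p.valRing.valuation y < 1 := by
  rw [residue, IsLocalRing.residue_eq_zero_iff, ValuationSubring.valuation_lt_one_iff]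

theorem aeval_mem (p : Place k K) {y : K} (hy : y ∈ p.valRing) (g : Polynomial k) :
    Polynomial.aeval y g ∈ p.valRing := by
  have : Polynomial.aeval y g = (Polynomial.aeval (⟨y, hy⟩ : p.valRing) g : p.valRing) :=
    Polynomial.aeval_algebraMap_apply K (⟨y, hy⟩ : p.valRing) g
  rw [this]
  exact Subtype.coe_prop _

theorem aeval_residue (p : Place k K) {y : K} (hy : y ∈ p.valRing) (g : Polynomial k) :
    Polynomial.aeval (p.residue hy) g = p.residue (p.aeval_mem hy g) := by
  have h1 : Polynomial.aeval (p.residue hy) g =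
      IsLocalRing.residue p.valRing (Polynomial.aeval (⟨y, hy⟩ : p.valRing) g) :=
    Polynomial.aeval_algebraMap_apply (IsLocalRing.ResidueField p.valRing)
      (⟨y, hy⟩ : p.valRing) g
  rw [h1, residue]
  congr 1
  exact Subtype.ext (Polynomial.aeval_algebraMap_apply K (⟨y, hy⟩ : p.valRing) g).symm

theorem aeval_residue_eq_zero_iff (p : Place k K) {y : K} (hy : y ∈ p.valRing)
    (g : Polynomial k) :
    Polynomial.aeval (p.residue hy) g = 0 ↔ p.valRing.valuation (Polynomial.aeval y g) < 1 := by
  rw [aeval_residue, residue_eq_zero_iff]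

/-- A reduced fraction which is integral at `p` has a denominator which is a unit at `p`. -/
theorem aeval_residue_ne_zero_of_isCoprime (p : Place k K) {y : K} (hy : y ∈ p.valRing)
    {g h : Polynomial k} (hgh : IsCoprime g h) (h0 : Polynomial.aeval y h ≠ 0)
    (hmem : Polynomial.aeval y g / Polynomial.aeval y h ∈ p.valRing) :
    Polynomial.aeval (p.residue hy) h ≠ 0 := by
  intro hzero
  have hg : Polynomial.aeval (p.residue hy) g = 0 := by
    rw [aeval_residue_eq_zero_iff] at hzero ⊢
    rw [← div_mul_cancel₀ (Polynomial.aeval y g) h0, map_mul]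
    exact mul_lt_one_of_nonneg_of_lt_one_right
      ((ValuationSubring.valuation_le_one_iff _ _).mpr hmem) zero_le hzero
  obtain ⟨a, b, hab⟩ := hgh
  have := congrArg (Polynomial.aeval (p.residue hy)) hab
  simp [hg, hzero] at this

theorem residue_mem_adjoin (p : Place k K) {y r : K} (hy : y ∈ p.valRing)
    (hr : r ∈ IntermediateField.adjoin k {y}) (hrp : r ∈ p.valRing) :
    p.residue hrp ∈ IntermediateField.adjoin k {p.residue hy} := by
  obtain ⟨g, h, hgh, h0, rfl⟩ := exists_isCoprime_of_mem_adjoin hr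
  have hne := p.aeval_residue_ne_zero_of_isCoprime hy hgh h0 hrp
  refine (IntermediateField.mem_adjoin_simple_iff k _).mpr ⟨g, h, ?_⟩
  rw [eq_div_iff hne, aeval_residue, aeval_residue, residue, residue, residue, ← map_mul]
  congr 1
  exact Subtype.ext (div_mul_cancel₀ _ h0)

end Residue

section Rational

variable {k K : Type*} [Field k] [Field K] [Algebra k K] {R : IntermediateField k K}

section Algebraic

variable [Algebra.IsAlgebraic R K]

/-- The residue class of `y` is a root of the numerator of a uniformizer of `p ∩ k(y)`. -/
theorem isIntegral_residue (p : Place k K) {y : K} (hy : y ∈ p.valRing)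
    (hR : R = IntermediateField.adjoin k {y}) : IsIntegral k (p.residue hy) := by
  obtain ⟨ϖ, hϖ⟩ := IsDiscreteValuationRing.exists_irreducible (p.below R).valRing
  have hlt := (valuation_below_lt_one_iff p (ϖ : R)).mp
    ((ValuationSubring.valuation_lt_one_iff _ _).mp hϖ.not_isUnit)
  have hmem : ((ϖ : R) : K) ∈ IntermediateField.adjoin k {y} := hR ▸ (ϖ : R).2
  obtain ⟨g, h, -, h0, hgh⟩ := exists_isCoprime_of_mem_adjoin hmem
  have hϖ0 : ((ϖ : R) : K) ≠ 0 := by simpa using hϖ.ne_zero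
  rw [← isAlgebraic_iff_isIntegral]
  refine ⟨g, ?_, ?_⟩
  · rintro rfl
    rw [map_zero, zero_div] at hgh
    exact hϖ0 hgh
  · rw [aeval_residue_eq_zero_iff]
    rw [eq_div_iff h0] at hgh
    rw [← hgh, map_mul]
    exact mul_lt_one_of_nonneg_of_lt_one_left zero_le hlt
      ((ValuationSubring.valuation_le_one_iff _ _).mpr (p.aeval_mem hy h))

/-- A place of `k(y)` at which `y` is integral is determined by the minimal polynomial of the
residue class of `y`. -/
theorem below_eq_of_minpoly_eq {p p' : Place k K} {y : K} (hy : y ∈ p.valRing)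
    (hy' : y ∈ p'.valRing) (hR : R = IntermediateField.adjoin k {y})
    (h : minpoly k (p.residue hy) = minpoly k (p'.residue hy')) :
    p.below R = p'.below R := by
  refine eq_of_le fun r hr => ?_
  rw [mem_below_iff] at hr ⊢
  change (r : K) ∈ p.valRing at hr
  change (r : K) ∈ p'.valRing
  have hmem : (r : K) ∈ IntermediateField.adjoin k {y} := hR ▸ r.2
  obtain ⟨f, g, hfg, h0, hr'⟩ := exists_isCoprime_of_mem_adjoin hmem
  rw [hr'] at hr ⊢
  have hne := p.aeval_residue_ne_zero_of_isCoprime hy hfg h0 hr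
  rw [Ne, ← minpoly.dvd_iff, h, minpoly.dvd_iff, aeval_residue_eq_zero_iff, not_lt] at hne
  rw [← ValuationSubring.valuation_le_one_iff, map_div₀]
  exact div_le_one_of_le₀ (((ValuationSubring.valuation_le_one_iff _ _).mpr
    (p'.aeval_mem hy' f)).trans hne) zero_le

end Algebraic

variable [Algebra.IsQuadraticExtension R K] {σ : K ≃ₐ[R] K}

/-- Scaling the quadratic equation of an integral element so that its coefficients are integral
and not all in the maximal ideal. -/
theorem exists_primitive_quadratic (hσ : σ ≠ AlgEquiv.refl) (p : Place k K) (z : K) :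
    ∃ a b c : K, a ∈ R ∧ b ∈ R ∧ c ∈ R ∧ a ∈ p.valRing ∧ b ∈ p.valRing ∧ c ∈ p.valRing ∧
      (a = 1 ∨ b = 1 ∨ c = 1) ∧ a * z ^ 2 + b * z + c = 0 := by
  classical
  obtain ⟨t, ht⟩ := exists_algebraMap_eq_add hσ z
  obtain ⟨n, hn⟩ := exists_algebraMap_eq_mul hσ z
  change (t : K) = z + σ z at ht
  change (n : K) = z * σ z at hn
  -- The coefficients of `X ^ 2 - t X + n` are divided by one of maximal valuation.
  obtain ⟨m, hm, hmax⟩ := Finset.exists_max_image ({1, -t, n} : Finset R)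
    (fun r => p.valRing.valuation (r : K)) ⟨1, by simp⟩
  have hm1 := hmax 1 (by simp)
  have hmt := hmax (-t) (by simp)
  have hmn := hmax n (by simp)
  have hm0 : (m : K) ≠ 0 := by
    intro h0
    rw [h0] at hm1
    simp at hm1
  have hmem (r : R) (hr : p.valRing.valuation (r : K) ≤ p.valRing.valuation (m : K)) :
      ((r / m : R) : K) ∈ p.valRing := by
    rw [← ValuationSubring.valuation_le_one_iff, IntermediateField.coe_div, map_div₀]
    exact div_le_one_of_le₀ hr zero_le
  refine ⟨((1 / m : R) : K), ((-t / m : R) : K), ((n / m : R) : K), Subtype.coe_prop _,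
    Subtype.coe_prop _, Subtype.coe_prop _, hmem _ hm1, hmem _ hmt, hmem _ hmn, ?_, ?_⟩
  · have hm0' : m ≠ 0 := fun h0 => hm0 (by rw [h0]; rfl)
    simp only [Finset.mem_insert, Finset.mem_singleton] at hm
    rcases hm with h | h | h
    · exact Or.inl (by rw [← h, div_self hm0']; rfl)
    · exact Or.inr (Or.inl (by rw [← h, div_self hm0']; rfl))
    · exact Or.inr (Or.inr (by rw [← h, div_self hm0']; rfl))
  · push_cast
    rw [ht, hn]
    field_simp
    ring

/-- Over a finite field `k` residue fields are finite: the residue field of `p ∩ k(y)` is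
generated by the class of `y`, and the elements of the residue field of `p` satisfy nontrivial
equations of degree at most two over it. -/
theorem finite_residueField [Finite k] (hσ : σ ≠ AlgEquiv.refl) (p : Place k K) {y : K}
    (hy : y ∈ p.valRing) (hR : R = IntermediateField.adjoin k {y}) :
    Finite (IsLocalRing.ResidueField p.valRing) := by
  let L := IntermediateField.adjoin k {p.residue hy}
  have hfd : FiniteDimensional k L :=
    IntermediateField.adjoin.finiteDimensional (p.isIntegral_residue hy hR)
  have hL : Finite L := Module.finite_of_finite k
  let P (v : L × L × L) : Polynomial (IsLocalRing.ResidueField p.valRing) :=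
    Polynomial.C (v.1 : IsLocalRing.ResidueField p.valRing) * Polynomial.X ^ 2 +
      Polynomial.C (v.2.1 : IsLocalRing.ResidueField p.valRing) * Polynomial.X +
      Polynomial.C (v.2.2 : IsLocalRing.ResidueField p.valRing)
  rw [← Set.finite_univ_iff]
  refine (Set.Finite.biUnion (Set.toFinite {v | P v ≠ 0})
    fun v hv => Polynomial.finite_setOfPred_isRoot hv).subset fun z _ => ?_
  obtain ⟨⟨z, hz⟩, rfl⟩ := IsLocalRing.residue_surjective z
  obtain ⟨a, b, c, haR, hbR, hcR, ha, hb, hc, hone, hrel⟩ := exists_primitive_quadratic hσ p z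
  rw [hR] at haR hbR hcR
  refine Set.mem_biUnion (x := (⟨_, p.residue_mem_adjoin hy haR ha⟩,
    ⟨_, p.residue_mem_adjoin hy hbR hb⟩, ⟨_, p.residue_mem_adjoin hy hcR hc⟩)) ?_ ?_
  · have hres (x : K) (hx : x ∈ p.valRing) (h1 : x = 1) : p.residue hx ≠ 0 := by
      rw [Ne, residue_eq_zero_iff, h1, map_one]
      exact lt_irrefl _
    intro h0
    have h2 := congrArg (Polynomial.coeff · 2) h0
    have h1 := congrArg (Polynomial.coeff · 1) h0
    have h00 := congrArg (Polynomial.coeff · 0) h0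
    simp [P, Polynomial.coeff_X, Polynomial.coeff_C] at h2 h1 h00
    rcases hone with h | h | h
    · exact hres a ha h h2
    · exact hres b hb h h1
    · exact hres c hc h h00
  · change Polynomial.eval _ _ = 0
    simp only [P, Polynomial.eval_add, Polynomial.eval_mul, Polynomial.eval_C,
      Polynomial.eval_pow, Polynomial.eval_X, residue, ← map_mul, ← map_pow, ← map_add]
    rw [← map_zero (IsLocalRing.residue p.valRing)]
    exact congrArg _ (Subtype.ext hrel)

theorem deg_pos [Finite k] (hσ : σ ≠ AlgEquiv.refl) (p : Place k K) {y : K}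
    (hy : y ∈ p.valRing) (hR : R = IntermediateField.adjoin k {y}) : 0 < p.deg := by
  have := finite_residueField hσ p hy hR
  have : Module.Finite k (IsLocalRing.ResidueField p.valRing) := Module.Finite.of_finite
  exact Module.finrank_pos

/-- Such places fall into classes according to the minimal polynomial of the residue of `y`, and
each class is contained in a pair of conjugate places. -/
theorem finite_setOf_deg_le_of_mem [Finite k] (hσ : σ ≠ AlgEquiv.refl) {y : K}
    (hR : R = IntermediateField.adjoin k {y}) (d : ℕ) :
    {p : Place k K | y ∈ p.valRing ∧ p.deg ≤ d}.Finite := by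
  have hpoly : Finite (Polynomial.degreeLT k (d + 1)) :=
    Finite.of_equiv _ (Polynomial.degreeLTEquiv k (d + 1)).symm.toEquiv
  have hfiber (f : Polynomial k) :
      {p : Place k K | ∃ hy : y ∈ p.valRing, minpoly k (p.residue hy) = f}.Finite := by
    rcases Set.eq_empty_or_nonempty
      {p : Place k K | ∃ hy : y ∈ p.valRing, minpoly k (p.residue hy) = f} with h | ⟨q, hq, hqf⟩
    · rw [h]
      exact Set.finite_empty
    · refine (Set.toFinite {q, q.conj σ}).subset ?_
      rintro p ⟨hp, hpf⟩
      exact (below_eq_iff hσ).mp (below_eq_of_minpoly_eq hp hq hR (hpf.trans hqf.symm))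
  refine (Set.Finite.biUnion (Set.toFinite (Polynomial.degreeLT k (d + 1) : Set (Polynomial k)))
    fun f _ => hfiber f).subset ?_
  rintro p ⟨hy, hd⟩
  refine Set.mem_biUnion (x := minpoly k (p.residue hy)) ?_ ⟨hy, rfl⟩
  have := finite_residueField hσ p hy hR
  have : Module.Finite k (IsLocalRing.ResidueField p.valRing) := Module.Finite.of_finite
  refine Polynomial.mem_degreeLT.mpr ((Polynomial.natDegree_lt_iff_degree_lt ?_).mp ?_)
  · exact minpoly.ne_zero (p.isIntegral_residue hy hR)
  · exact Nat.lt_succ_of_le ((minpoly.natDegree_le _).trans hd)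

end Rational

end Place

section Finiteness

variable {k K : Type*} [Field k] [Field K] [Algebra k K] {R : IntermediateField k K}

theorem exists_eq_adjoin_and_eq_adjoin_inv (hR : IsRationalSubfield R) :
    ∃ x : K, R = IntermediateField.adjoin k {x} ∧ R = IntermediateField.adjoin k {x⁻¹} := by
  obtain ⟨x, -, rfl⟩ := hR
  refine ⟨x, rfl, le_antisymm ?_ ?_⟩
  · rw [IntermediateField.adjoin_simple_le_iff]
    simpa using inv_mem (IntermediateField.mem_adjoin_simple_self k x⁻¹)
  · rw [IntermediateField.adjoin_simple_le_iff]
    exact inv_mem (IntermediateField.mem_adjoin_simple_self k x)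

variable [Algebra.IsQuadraticExtension R K] {σ : K ≃ₐ[R] K}

/-- The degree bounds both the coefficients and the degrees of the places in the support. -/
theorem finite_Red [Finite k] (hR : IsRationalSubfield R) (hσ : σ ≠ AlgEquiv.refl)
    (S : Set (Place k K)) (d : ℕ) : (Red R S d).Finite := by
  classical
  obtain ⟨x, hx, hx'⟩ := exists_eq_adjoin_and_eq_adjoin_inv hR
  have hpos (p : Place k K) : 0 < p.deg := by
    rcases p.valRing.mem_or_inv_mem x with h | h
    · exact Place.deg_pos hσ p h hx
    · exact Place.deg_pos hσ p h hx'
  have hplaces : {p : Place k K | p.deg ≤ d}.Finite := by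
    refine ((Place.finite_setOf_deg_le_of_mem hσ hx d).union
      (Place.finite_setOf_deg_le_of_mem hσ hx' d)).subset fun p hp => ?_
    exact (p.valRing.mem_or_inv_mem x).imp (fun h => ⟨h, hp⟩) fun h => ⟨h, hp⟩
  let E : Divisor k K := Finsupp.indicator hplaces.toFinset fun _ _ => (d : ℤ)
  refine (Set.finite_Icc 0 E).subset fun D hD => ⟨hD.1, fun p => ?_⟩
  by_cases h0 : D p = 0
  · rw [h0, Finsupp.indicator_apply]
    split_ifs <;> simp
  · have hDp : 0 ≤ D p := hD.1 p
    have hle : D p * p.deg ≤ d := by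
      rw [← hD.2.1]
      exact Finset.single_le_sum (f := fun q => D q * (q.deg : ℤ))
        (fun q _ => mul_nonneg (hD.1 q) (Int.natCast_nonneg _)) (Finsupp.mem_support_iff.mpr h0)
    have h1 : (1 : ℤ) ≤ p.deg := by exact_mod_cast hpos p
    have h2 : 1 ≤ D p := by omega
    have hdeg : (p.deg : ℤ) ≤ d := by nlinarith
    have hcoeff : D p ≤ d := by nlinarith
    rw [Finsupp.indicator_of_mem (by simpa using hdeg)]
    exact hcoeff

end Finiteness

end FuncField

theorem mainTheorem7 {k K : Type*} [Field k] [Field K] [Algebra k K]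
    (R : IntermediateField k K) (hR : IsRationalSubfield R)
    [Algebra.IsQuadraticExtension R K] (σ : K ≃ₐ[R] K) (hσ : σ ≠ AlgEquiv.refl) :
    (Finite k → ∀ (S : Set (Place k K)) (d : ℕ), (Red R S d).Finite) ∧
    ∀ (S : Set (Place k K)), (∀ d : ℕ, (Red R S d).Finite) →
      ∀ p₁ p₂ : Place k K, p₁ ∉ S → p₂ ∉ S →
        (p₁ ≠ p₂ → p₂ = p₁.conj σ →
          genFun R (S ∪ {p₁, p₂}) =
            (1 - PowerSeries.X ^ p₁.deg) * (1 + PowerSeries.X ^ p₁.deg)⁻¹ * genFun R S) ∧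
        (p₁ = p₂ → p₂ = p₁.conj σ → ¬ (p₁.below R).IsInert K →
          genFun R (S ∪ {p₁, p₂}) = (1 + PowerSeries.X ^ p₁.deg)⁻¹ * genFun R S) ∧
        (p₁ = p₂ → p₂ = p₁.conj σ → (p₁.below R).IsInert K →
          genFun R (S ∪ {p₁, p₂}) = genFun R S) ∧
        (p₁ = p₂ → p₁.conj σ ∈ S →
          genFun R (S ∪ {p₁, p₂}) = (1 - PowerSeries.X ^ p₁.deg) * genFun R S) := by
  refine ⟨fun _ S d => finite_Red hR hσ S d, fun S hS p₁ p₂ h₁ h₂ => ⟨?_, ?_, ?_, ?_⟩⟩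
  · rintro hne rfl
    rw [mul_assoc, mul_left_comm, ← genFun_union_of_split hσ hS h₁ h₂ hne.symm, ← mul_assoc,
      PowerSeries.inv_mul_cancel _ (constantCoeff_one_add_X_pow_ne_zero _), one_mul]
  · rintro rfl hconj hin
    have he : p₁.ramIdx R = 2 := by
      refine ((Nat.dvd_prime Nat.prime_two).mp
        (Place.ramIdx_dvd_two hσ hconj.symm)).resolve_left fun h1 =>
          hin ⟨p₁, fun p' => ⟨?_, ?_⟩, h1⟩
      · exact eq_of_below_eq_of_conj_eq hσ hconj.symm
      · rintro rfl
        rfl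
    rw [Set.pair_eq_singleton, ← genFun_union_of_ramified hσ hS h₁ hconj.symm he, ← mul_assoc,
      PowerSeries.inv_mul_cancel _ (constantCoeff_one_add_X_pow_ne_zero _), one_mul]
  · rintro rfl hconj ⟨p, hp, he⟩
    obtain rfl := (hp p₁).mp rfl
    rw [Set.pair_eq_singleton, genFun_union_of_inert hσ hconj.symm he]
  · rintro rfl hconj
    rw [Set.pair_eq_singleton, genFun_union_of_conj_mem hS h₁ hconj]
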